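/- **Setting.** Let $\mathcal X\subseteq\mathbb R^N$, let $\mu$ be a measure on the Borel sets of $\mathbb R^M$, and let $f(\cdot;\mathbf x)\ge 0$, $\mathbf x\in\mathcal X$, be probability densities with respect to $\mu$; $\mathsf E_{\mathbf x}$ denotes expectation under $f(\cdot;\mathbf x)\,d\mu$. Let $\mathbf x_0$ be an interior point of $\mathcal X$. Assume $f(\mathbf y;\mathbf x_0)\ne 0$ for $\mu$-almost every $\mathbf y$, put $\rho(\mathbf y,\mathbf x)=f(\mathbf y;\mathbf x)/f(\mathbf y;\mathbf x_0)$ (and $0$ where $f(\mathbf y;\mathbf x_0)=0$), and assume that $R(\mathbf x_1,\mathbf x_2)=\mathsf E_{\mathbf x_0}\{\rho(\mathbf y,\mathbf x_1)\rho(\mathbf y,\mathbf x_2)\}$ is finite for all $\mathbf x_1,\mathbf x_2\in\mathcal X$. Let $\mathcal H$ be the reproducing kernel Hilbert space of functions on $\mathcal X$ with kernel $R$. For a multi-index $\mathbf p\in\mathbb Z_+^N$, $\partial^{\mathbf p}/\partial\mathbf x^{\mathbf p}=\partial^{p_1}/\partial x_1^{p_1}\cdots\partial^{p_N}/\partial x_N^{p_N}$.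 **Regularity.** Let $m\ge 1$. The problem is *regular up to order $m$ at $\mathbf x_0$* if there is $r>0$ such that the open ball $\mathcal B=\mathcal B(\mathbf x_0,r)$ lies in $\mathcal X$ and, for all multi-indices $\mathbf p,\mathbf p_1,\mathbf p_2$ with entries at most $m$: 1. for $\mu$-almost every $\mathbf y$, $\partial^{\mathbf p}f(\mathbf y;\mathbf x)/\partial\mathbf x^{\mathbf p}$ exists on $\mathcal B$, and $\mathsf E_{\mathbf x_0}\big\{\big(\tfrac{1}{f(\mathbf y;\mathbf x_0)}\tfrac{\partial^{\mathbf p}f(\mathbf y;\mathbf x)}{\partial\mathbf x^{\mathbf p}}\big)^2\big\}<\infty$ for all $\mathbf x\in\mathcal B$; 2. for every measurable $h:\mathbb R^M\to\mathbb R$ such that $\mathsf E_{\mathbf x}\{h(\mathbf y)\}$ exists for all $\mathbf x\in\mathcal X$, the derivative $\partial^{\mathbf p}\mathsf E_{\mathbf x}\{h(\mathbf y)\}/\partial\mathbf x^{\mathbf p}$ exists on $\mathcal B$ and equals $\int h(\mathbf y)\,\tfrac{\partial^{\mathbf p}f(\mathbf y;\mathbf x)}{\partial\mathbf x^{\mathbf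 p}}\,d\mu(\mathbf y)$ for all $\mathbf x\in\mathcal B$, provided that this integrand is integrable for all $\mathbf x\in\mathcal B$; 3. $\mathsf E_{\mathbf x_0}\big\{\tfrac{1}{f^2(\mathbf y;\mathbf x_0)}\tfrac{\partial^{\mathbf p_1}f(\mathbf y;\mathbf x_1)}{\partial\mathbf x_1^{\mathbf p_1}}\tfrac{\partial^{\mathbf p_2}f(\mathbf y;\mathbf x_2)}{\partial\mathbf x_2^{\mathbf p_2}}\big\}$ is continuous in $(\mathbf x_1,\mathbf x_2)\in\mathcal B\times\mathcal B$. **Theorem.** Let the problem be regular up to order $m$ at $\mathbf x_0$, and let $\mathbf p_1,\dots,\mathbf p_L$ be distinct *nonzero* multi-indices with entries at most $m$. Let $\hat g:\mathbb R^M\to\mathbb R$ be a measurable estimator with finite variance $v(\hat g;\mathbf x_0)$ at $\mathbf x_0$ (that is, $\mathsf E_{\mathbf x_0}\{\hat g(\mathbf y)^2\}<\infty$). Then: - the mean function $\gamma(\mathbf x)=\mathsf E_{\mathbf x}\{\hat g(\mathbf y)\}$ is defined for all $\mathbf x\in\mathcal X$ and belongs to $\mathcal H$, and the partial derivatives of $\gamma$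 and of $R(\mathbf x',\cdot)$, $\mathbf x'\in\mathcal X$, of orders $\mathbf p_1,\dots,\mathbf p_L$ exist near $\mathbf x_0$; - the functions $u_0=R(\cdot,\mathbf x_0)$ and $u_l=\frac{\partial^{\mathbf p_l}R(\cdot,\mathbf x)}{\partial\mathbf x^{\mathbf p_l}}\big|_{\mathbf x=\mathbf x_0}$, $l=1,\dots,L$, belong to $\mathcal H$; - with $\mathcal U_{\mathrm B}=\mathrm{span}\{u_0,u_1,\dots,u_L\}$ and $\gamma_{\mathcal U_{\mathrm B}}$ the orthogonal projection of $\gamma$ onto $\mathcal U_{\mathrm B}$, $$v(\hat g;\mathbf x_0)\ \ge\ \|\gamma_{\mathcal U_{\mathrm B}}\|_{\mathcal H}^2-\gamma(\mathbf x_0)^2\ =\ \mathbf a^T\mathbf B^\dagger\mathbf a ,$$ where $a_l=\frac{\partial^{\mathbf p_l}\gamma(\mathbf x)}{\partial\mathbf x^{\mathbf p_l}}\big|_{\mathbf x=\mathbf x_0}$, $B_{l,l'}=\mathsf E_{\mathbf x_0}\Big\{\frac{1}{f^2(\mathbf y;\mathbf x_0)}\frac{\partial^{\mathbf p_l}f(\mathbf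 y;\mathbf x)}{\partial\mathbf x^{\mathbf p_l}}\frac{\partial^{\mathbf p_{l'}}f(\mathbf y;\mathbf x)}{\partial\mathbf x^{\mathbf p_{l'}}}\Big|_{\mathbf x=\mathbf x_0}\Big\}$, and $\mathbf B^\dagger$ is the Moore–Penrose pseudoinverse. That is, the Bhattacharyya bound $v(\hat g;\mathbf x_0)\ge\mathbf a^T\mathbf B^\dagger\mathbf a$ is the projection bound for the subspace $\mathcal U_{\mathrm B}$. -/

import Mathlib

open MeasureTheory ProbabilityTheory
open scoped Matrix ENNReal

noncomputable section

/-! ### The Moore-Penrose pseudoinverse of a real matrix -/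

/-- `P` satisfies the four Penrose equations for `A`. -/
structure IsMoorePenrose {m n : Type*} [Fintype m] [Fintype n]
    (A : Matrix m n ℝ) (P : Matrix n m ℝ) : Prop where
  mul_mul_left : A * P * A = A
  mul_mul_right : P * A * P = P
  symm_left : (A * P)ᵀ = A * P
  symm_right : (P * A)ᵀ = P * A

theorem IsMoorePenrose.eq {m n : Type*} [Fintype m] [Fintype n]
    {A : Matrix m n ℝ} {P Q : Matrix n m ℝ}
    (hP : IsMoorePenrose A P) (hQ : IsMoorePenrose A Q) : P = Q := by
  have h1 : A * P = A * Q := by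
    calc A * P = A * Q * (A * P) := by rw [← Matrix.mul_assoc, hQ.mul_mul_left]
      _ = (A * Q)ᵀ * (A * P)ᵀ := by rw [hQ.symm_left, hP.symm_left]
      _ = (A * P * A * Q)ᵀ := by rw [← Matrix.transpose_mul]; simp only [Matrix.mul_assoc]
      _ = A * Q := by rw [hP.mul_mul_left, hQ.symm_left]
  have h2 : P * A = Q * A := by
    calc P * A = P * A * (Q * A) := by
            rw [← Matrix.mul_assoc, Matrix.mul_assoc (P * A), Matrix.mul_assoc P,
              ← Matrix.mul_assoc A, hQ.mul_mul_left]
      _ = (P * A)ᵀ * (Q * A)ᵀ := by rw [hQ.symm_right, hP.symm_right]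
      _ = (Q * (A * P * A))ᵀ := by rw [← Matrix.transpose_mul]; simp only [Matrix.mul_assoc]
      _ = Q * A := by rw [hP.mul_mul_left, hQ.symm_right]
  calc P = P * A * P := hP.mul_mul_right.symm
    _ = Q * A * P := by rw [h2]
    _ = Q * A * Q := by rw [Matrix.mul_assoc, h1, ← Matrix.mul_assoc]
    _ = Q := hQ.mul_mul_right

theorem exists_isMoorePenrose_of_symm {n : Type*} [Fintype n]
    (S : Matrix n n ℝ) (hS : Sᵀ = S) :
    ∃ Q : Matrix n n ℝ, Qᵀ = Q ∧ S * Q * S = S ∧ Q * S * Q = Q ∧ (Q * S)ᵀ = Q * S := by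
  classical
  have hH : S.IsHermitian := by
    rw [Matrix.IsHermitian, Matrix.conjTranspose_eq_transpose_of_trivial, hS]
  obtain ⟨U, d, hU1, hU⟩ : ∃ (U : Matrix n n ℝ) (d : n → ℝ),
      Uᵀ * U = 1 ∧ S = U * Matrix.diagonal d * Uᵀ := by
    refine ⟨hH.eigenvectorUnitary, hH.eigenvalues, ?_, ?_⟩
    · have := (Matrix.mem_unitaryGroup_iff' (A := (hH.eigenvectorUnitary : Matrix n n ℝ))).1
        hH.eigenvectorUnitary.2
      rwa [Matrix.star_eq_conjTranspose, Matrix.conjTranspose_eq_transpose_of_trivial] at this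
    · have := hH.spectral_theorem
      simpa [Unitary.conjStarAlgAut_apply, Matrix.star_eq_conjTranspose,
        Matrix.conjTranspose_eq_transpose_of_trivial, Function.comp_def] using this
  have key : ∀ a b : n → ℝ, U * Matrix.diagonal a * Uᵀ * (U * Matrix.diagonal b * Uᵀ)
      = U * Matrix.diagonal (fun i => a i * b i) * Uᵀ := by
    intro a b
    calc _ = U * Matrix.diagonal a * (Uᵀ * U) * Matrix.diagonal b * Uᵀ := by
          simp only [Matrix.mul_assoc]
      _ = _ := by
          rw [hU1, Matrix.mul_one, Matrix.mul_assoc U, Matrix.diagonal_mul_diagonal]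
  have keyT : ∀ a : n → ℝ, (U * Matrix.diagonal a * Uᵀ)ᵀ = U * Matrix.diagonal a * Uᵀ := by
    intro a
    simp [Matrix.transpose_mul, Matrix.mul_assoc]
  have hd : ∀ i, d i * (d i)⁻¹ * d i = d i := fun i => mul_inv_mul_cancel _
  have hd' : ∀ i, (d i)⁻¹ * d i * (d i)⁻¹ = (d i)⁻¹ := fun i => by
    simpa using mul_inv_mul_cancel (d i)⁻¹
  refine ⟨U * Matrix.diagonal (fun i => (d i)⁻¹) * Uᵀ, keyT _, ?_, ?_, ?_⟩
  · rw [hU, key, key]; simp only [hd]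
  · rw [hU, key, key]; simp only [hd']
  · rw [hU, key, keyT]

theorem exists_isMoorePenrose {m n : Type*} [Fintype m] [Fintype n]
    (A : Matrix m n ℝ) : ∃ P, IsMoorePenrose A P := by
  classical
  obtain ⟨Q, hQ, h1, h2, h3⟩ := exists_isMoorePenrose_of_symm (Aᵀ * A)
    (by simp [Matrix.transpose_mul])
  have hA : A * Q * (Aᵀ * A) = A := by
    have h0 : (A * (Q * (Aᵀ * A) - 1))ᵀ * (A * (Q * (Aᵀ * A) - 1)) = 0 := by
      calc (A * (Q * (Aᵀ * A) - 1))ᵀ * (A * (Q * (Aᵀ * A) - 1))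
          = (Q * (Aᵀ * A) - 1)ᵀ * (Aᵀ * A * Q * (Aᵀ * A) - Aᵀ * A) := by
            rw [Matrix.transpose_mul]
            simp only [Matrix.mul_assoc, Matrix.mul_sub, Matrix.mul_one]
        _ = 0 := by rw [h1, sub_self, Matrix.mul_zero]
    rw [← Matrix.conjTranspose_eq_transpose_of_trivial,
      Matrix.conjTranspose_mul_self_eq_zero] at h0
    rw [Matrix.mul_sub, Matrix.mul_one, sub_eq_zero] at h0
    rw [Matrix.mul_assoc, h0]
  refine ⟨Q * Aᵀ, ?_, ?_, ?_, ?_⟩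
  · calc A * (Q * Aᵀ) * A = A * Q * (Aᵀ * A) := by simp only [Matrix.mul_assoc]
      _ = A := hA
  · calc Q * Aᵀ * A * (Q * Aᵀ) = Q * (Aᵀ * A) * Q * Aᵀ := by simp only [Matrix.mul_assoc]
      _ = Q * Aᵀ := by rw [h2]
  · simp [Matrix.transpose_mul, hQ, Matrix.mul_assoc]
  · rw [Matrix.mul_assoc, h3]

/-- The Moore-Penrose pseudoinverse `A†`: the unique solution of the Penrose equations. -/
def pinv {m n : Type*} [Fintype m] [Fintype n] (A : Matrix m n ℝ) : Matrix n m ℝ :=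
  (exists_isMoorePenrose A).choose

theorem pinv_spec {m n : Type*} [Fintype m] [Fintype n] (A : Matrix m n ℝ) :
    IsMoorePenrose A (pinv A) :=
  (exists_isMoorePenrose A).choose_spec

/-! ### Partial derivatives of multi-index order -/

/-- The word `1 ⋯ 1 2 ⋯ 2 ⋯ N ⋯ N` in which each `k` occurs `p k` times. -/
def multiWord {N : ℕ} (p : Fin N → ℕ) : List (Fin N) :=
  (List.finRange N).flatMap fun k => List.replicate (p k) k

/-- Successive partial derivatives along a word; the last letter is differentiated first. -/
def wordDeriv {N : ℕ} :
    List (Fin N) → (EuclideanSpace ℝ (Fin N) → ℝ) → EuclideanSpace ℝ (Fin N) → ℝ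
  | [], φ => φ
  | k :: w, φ => fun x => lineDeriv ℝ (wordDeriv w φ) x (EuclideanSpace.single k 1)

/-- All the partial derivatives that occur in `wordDeriv w φ` exist on `U`. -/
def WordDerivExistsOn {N : ℕ} :
    List (Fin N) → (EuclideanSpace ℝ (Fin N) → ℝ) → Set (EuclideanSpace ℝ (Fin N)) → Prop
  | [], _, _ => True
  | k :: w, φ, U => WordDerivExistsOn w φ U ∧
      ∀ x ∈ U, LineDifferentiableAt ℝ (wordDeriv w φ) x (EuclideanSpace.single k 1)

/-- `∂^p φ / ∂x^p = ∂^{p₁}/∂x₁^{p₁} ⋯ ∂^{p_N}/∂x_N^{p_N} φ`. -/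
def partialDeriv {N : ℕ} (p : Fin N → ℕ) (φ : EuclideanSpace ℝ (Fin N) → ℝ) :
    EuclideanSpace ℝ (Fin N) → ℝ :=
  wordDeriv (multiWord p) φ

/-- The partial derivative of order `p` of `φ` exists on the (open) set `U`. -/
def PartialDerivExistsOn {N : ℕ} (p : Fin N → ℕ) (φ : EuclideanSpace ℝ (Fin N) → ℝ)
    (U : Set (EuclideanSpace ℝ (Fin N))) : Prop :=
  WordDerivExistsOn (multiWord p) φ U

/-- The partial derivative of order `p` of `φ` exists in a neighborhood of `x`. -/
def PartialDerivExistsNear {N : ℕ} (p : Fin N → ℕ) (φ : EuclideanSpace ℝ (Fin N) → ℝ)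
    (x : EuclideanSpace ℝ (Fin N)) : Prop :=
  ∃ r > 0, PartialDerivExistsOn p φ (Metric.ball x r)

/-! ### Estimation problems -/

/-- An estimation problem `(X, f(y; x), g)` with parameter set `X ⊆ ℝ^N` and observation in `ℝ^M`.
The values of `f` and `g` at parameters outside `X` are irrelevant. -/
structure EstimationProblem (N M : ℕ) where
  /-- the parameter set -/
  X : Set (EuclideanSpace ℝ (Fin N))
  /-- the dominating measure -/
  μ : Measure (EuclideanSpace ℝ (Fin M))
  /-- the densities: `f x y` is `f(y; x)` -/
  f : EuclideanSpace ℝ (Fin N) → EuclideanSpace ℝ (Fin M) → ℝ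
  /-- the parameter function -/
  g : EuclideanSpace ℝ (Fin N) → ℝ
  measurable_f : ∀ x ∈ X, Measurable (f x)
  nonneg_f : ∀ x ∈ X, ∀ y, 0 ≤ f x y
  lintegral_f : ∀ x ∈ X, ∫⁻ y, ENNReal.ofReal (f x y) ∂μ = 1

namespace EstimationProblem

variable {N M : ℕ}

/-- The law of the observation under the parameter `x`; expectations `E_x` are integrals
with respect to it. -/
def prob (E : EstimationProblem N M) (x : EuclideanSpace ℝ (Fin N)) :
    Measure (EuclideanSpace ℝ (Fin M)) :=
  E.μ.withDensity fun y => ENNReal.ofReal (E.f x y)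

/-- The mean function `x ↦ E_x {h(y)}`. -/
def mean (E : EstimationProblem N M) (h : EuclideanSpace ℝ (Fin M) → ℝ)
    (x : EuclideanSpace ℝ (Fin N)) : ℝ :=
  ∫ y, h y ∂E.prob x

/-- The likelihood ratio `f(y; x) / f(y; x₀)`, and `0` where `f(y; x₀) = 0`. -/
def likelihoodRatio (E : EstimationProblem N M) (x₀ x : EuclideanSpace ℝ (Fin N))
    (y : EuclideanSpace ℝ (Fin M)) : ℝ :=
  E.f x y / E.f x₀ y

/-- The standing assumptions at the reference parameter: `f(·; x₀)` vanishes almost nowhere for the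
dominating measure, and the correlations of the likelihood ratios are finite. -/
class Admissible (E : EstimationProblem N M) (x₀ : E.X) : Prop where
  ne_zero : ∀ᵐ y ∂E.μ, E.f x₀ y ≠ 0
  integrable : ∀ x₁ ∈ E.X, ∀ x₂ ∈ E.X,
    Integrable (fun y => E.likelihoodRatio x₀ x₁ y * E.likelihoodRatio x₀ x₂ y) (E.prob x₀)

/-- The kernel `R(x₁, x₂) = E_{x₀} {ρ(y, x₁) ρ(y, x₂)}`. -/
def kernel (E : EstimationProblem N M) (x₀ x₁ x₂ : EuclideanSpace ℝ (Fin N)) : ℝ :=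
  ∫ y, E.likelihoodRatio x₀ x₁ y * E.likelihoodRatio x₀ x₂ y ∂E.prob x₀

/-- The kernel on `X × X`, each value viewed as an operator on `ℝ`. -/
def kernelMatrix (E : EstimationProblem N M) (x₀ : E.X) : Matrix E.X E.X (ℝ →L[ℝ] ℝ) :=
  Matrix.of fun x₁ x₂ => E.kernel x₀ x₁ x₂ • ContinuousLinearMap.id ℝ ℝ

theorem kernel_comm (E : EstimationProblem N M) (x₀ x₁ x₂ : EuclideanSpace ℝ (Fin N)) :
    E.kernel x₀ x₁ x₂ = E.kernel x₀ x₂ x₁ := by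
  simp only [kernel, mul_comm]

theorem posSemidef_kernelMatrix (E : EstimationProblem N M) (x₀ : E.X) [h : E.Admissible x₀] :
    (E.kernelMatrix x₀).PosSemidef := by
  have htfae := (RKHS.posSemidef_tfae (K := E.kernelMatrix x₀)).out 0 2
  refine htfae.2 ⟨?_, ?_⟩
  · ext i j
    have hid : star (ContinuousLinearMap.id ℝ ℝ) = ContinuousLinearMap.id ℝ ℝ :=
      star_one (ℝ →L[ℝ] ℝ)
    simp [kernelMatrix, Matrix.conjTranspose_apply, E.kernel_comm x₀ j i, hid]
  · intro v
    have h1 : (v.sum fun x w => v.sum fun x' w' => inner ℝ (E.kernelMatrix x₀ x' x w) w')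
        = ∫ y, (∑ x ∈ v.support, v x * E.likelihoodRatio x₀ x y) ^ 2 ∂E.prob x₀ := by
      have h2 : ∀ y, (∑ x ∈ v.support, v x * E.likelihoodRatio x₀ x y) ^ 2
          = ∑ x ∈ v.support, ∑ x' ∈ v.support, v x * v x' *
            (E.likelihoodRatio x₀ x y * E.likelihoodRatio x₀ x' y) := by
        intro y
        rw [sq, Finset.sum_mul_sum]
        exact Finset.sum_congr rfl fun _ _ => Finset.sum_congr rfl fun _ _ => by ring
      simp only [h2]
      rw [integral_finsetSum]
      · refine Finset.sum_congr rfl fun x _ => ?_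
        rw [integral_finsetSum]
        · refine Finset.sum_congr rfl fun x' _ => ?_
          rw [integral_const_mul]
          have hk : E.kernelMatrix x₀ x' x (v x) = E.kernel x₀ x x' * v x := by
            simp [kernelMatrix, E.kernel_comm x₀ x' x]
          change inner ℝ (E.kernelMatrix x₀ x' x (v x)) (v x') = _
          rw [hk, RCLike.inner_apply, conj_trivial, kernel]
          ring
        · exact fun x' _ => (h.integrable x x.2 x' x'.2).const_mul _
      · exact fun x _ => integrable_finsetSum _ fun x' _ =>
          (h.integrable x x.2 x' x'.2).const_mul _
    rw [h1]
    exact integral_nonneg fun y => sq_nonneg _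

instance (E : EstimationProblem N M) (x₀ : E.X) [E.Admissible x₀] :
    Fact (E.kernelMatrix x₀).PosSemidef :=
  ⟨E.posSemidef_kernelMatrix x₀⟩

/-- The reproducing kernel Hilbert space of functions on `X` with the kernel `R`. -/
abbrev rkhs (E : EstimationProblem N M) (x₀ : E.X) [E.Admissible x₀] : Type :=
  RKHS.OfKernel (E.kernelMatrix x₀)

/-- Regularity up to order `m` at `x₀`. -/
def Regular (E : EstimationProblem N M) (x₀ : EuclideanSpace ℝ (Fin N)) (m : ℕ) : Prop :=
  ∃ r > 0, Metric.ball x₀ r ⊆ E.X ∧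
    (∀ p : Fin N → ℕ, (∀ k, p k ≤ m) →
      (∀ᵐ y ∂E.μ, PartialDerivExistsOn p (fun x => E.f x y) (Metric.ball x₀ r)) ∧
      ∀ x ∈ Metric.ball x₀ r,
        MemLp (fun y => 1 / E.f x₀ y * partialDeriv p (fun x => E.f x y) x) 2 (E.prob x₀)) ∧
    (∀ h : EuclideanSpace ℝ (Fin M) → ℝ, Measurable h →
      (∀ x ∈ E.X, Integrable h (E.prob x)) →
      ∀ p : Fin N → ℕ, (∀ k, p k ≤ m) →
        (∀ x ∈ Metric.ball x₀ r,
          Integrable (fun y => h y * partialDeriv p (fun x => E.f x y) x) E.μ) →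
        PartialDerivExistsOn p (E.mean h) (Metric.ball x₀ r) ∧
        ∀ x ∈ Metric.ball x₀ r,
          partialDeriv p (E.mean h) x = ∫ y, h y * partialDeriv p (fun x => E.f x y) x ∂E.μ) ∧
    (∀ p₁ p₂ : Fin N → ℕ, (∀ k, p₁ k ≤ m) → (∀ k, p₂ k ≤ m) →
      ContinuousOn (fun z : EuclideanSpace ℝ (Fin N) × EuclideanSpace ℝ (Fin N) =>
        ∫ y, 1 / E.f x₀ y ^ 2 * partialDeriv p₁ (fun x => E.f x y) z.1 *
          partialDeriv p₂ (fun x => E.f x y) z.2 ∂E.prob x₀)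
        (Metric.ball x₀ r ×ˢ Metric.ball x₀ r))

/-- The vector `a(x₀)` of the partial derivatives of the mean function of an estimator. -/
def bhattVector (E : EstimationProblem N M) (x₀ : EuclideanSpace ℝ (Fin N)) {L : ℕ}
    (p : Fin L → Fin N → ℕ) (ghat : EuclideanSpace ℝ (Fin M) → ℝ) : Fin L → ℝ :=
  fun l => partialDeriv (p l) (E.mean ghat) x₀

/-- The Bhattacharyya matrix `B(x₀)`. -/
def bhattMatrix (E : EstimationProblem N M) (x₀ : EuclideanSpace ℝ (Fin N)) {L : ℕ}
    (p : Fin L → Fin N → ℕ) : Matrix (Fin L) (Fin L) ℝ :=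
  Matrix.of fun l l' => ∫ y, 1 / E.f x₀ y ^ 2 * partialDeriv (p l) (fun x => E.f x y) x₀ *
    partialDeriv (p l') (fun x => E.f x y) x₀ ∂E.prob x₀

end EstimationProblem

/-- The span of `u₀` and `u₁, …, u_L`. -/
def spanWith {H : Type*} [NormedAddCommGroup H] [InnerProductSpace ℝ H] {L : ℕ}
    (u₀ : H) (u : Fin L → H) : Submodule ℝ H :=
  Submodule.span ℝ ({u₀} ∪ Set.range u)

instance {H : Type*} [NormedAddCommGroup H] [InnerProductSpace ℝ H] {L : ℕ}
    (u₀ : H) (u : Fin L → H) : FiniteDimensional ℝ (spanWith u₀ u) :=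
  FiniteDimensional.span_of_finite ℝ ((Set.finite_singleton u₀).union (Set.finite_range u))

end

/-! Everything is transported from `L²` of the law at `x₀`. The likelihood ratios `ρ_x` form a
feature map of the kernel, so `T v = (x ↦ ⟪v, ρ_x⟫)` is a contraction of `L²` into the RKHS that
keeps inner products with the closed span of the `ρ_x` (`RKHS.exists_featureOperator`). As `E_x h =
⟪h, ρ_x⟫`, `T` sends the estimator to its mean function `γ` and `ρ_{x₀}` to `u₀`. Differentiating
under the integral gives `∂^p E_x h = ⟪h, s_p⟫` at `x₀`, with `s_p` the normalized derivative of the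
density (`score`), so `T` sends `s_{p_l}` to `u_l`.

The scores lie in the closed span (`toLp_score_mem_closure_span`), so the `u_l` have Gram matrix `B`
and inner products `a_l` with `γ`. Moreover `u₀` is a unit vector with `⟪u₀, γ⟫ = γ(x₀)`, and `u₀ ⟂
u_l` because the mean of the constant `1` is constant. Linear algebra
(`norm_starProjection_spanWith_sq`) then gives the squared norm of the projection as `γ(x₀)² +
aᵀB†a`. The inequality holds because neither `T` nor the projection increases norms, while the
variance is `‖ghat‖² - γ(x₀)²`. -/

/-! ### Projection onto a span and the Gram matrix -/

/-- A vector of inner products with a finite family lies in the range of the Gram matrix. -/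
theorem gram_mulVec_pinv_mulVec {H : Type*} [NormedAddCommGroup H] [InnerProductSpace ℝ H] {L : ℕ}
    (u : Fin L → H) (γ : H) (B : Matrix (Fin L) (Fin L) ℝ) (hB : ∀ l l', B l l' = inner ℝ (u l) (u l'))
    (a : Fin L → ℝ) (ha : ∀ l, a l = inner ℝ (u l) γ) :
    B *ᵥ (pinv B *ᵥ a) = a := by
  have hP := pinv_spec B
  set P := pinv B
  have hBt : Bᵀ = B := by
    ext i j
    rw [Matrix.transpose_apply, hB, hB, real_inner_comm]
  have hBBP : B * (B * P) = B := by
    calc B * (B * P) = Bᵀ * (B * P)ᵀ := by rw [hBt, hP.symm_left]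
      _ = (B * P * B)ᵀ := by rw [← Matrix.transpose_mul]
      _ = B := by rw [hP.mul_mul_left, hBt]
  -- The residual `z` lies in the kernel of `B`, so `‖∑ z_l u_l‖² = zᵀBz = 0`. Hence `z` is
  -- orthogonal to `a` (pair that sum with `γ`) and, by symmetry, to the range of `B`, thus to
  -- itself.
  set z : Fin L → ℝ := a - B *ᵥ (P *ᵥ a) with hz
  have hBz : B *ᵥ z = 0 := by
    rw [hz, Matrix.mulVec_sub, Matrix.mulVec_mulVec, Matrix.mulVec_mulVec, Matrix.mul_assoc,
      hBBP, sub_self]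
  have hsum : ∑ l, z l • u l = 0 := by
    have h1 : inner ℝ (∑ l, z l • u l) (∑ l, z l • u l) = z ⬝ᵥ (B *ᵥ z) := by
      simp only [sum_inner, inner_sum, real_inner_smul_left, real_inner_smul_right, dotProduct,
        Matrix.mulVec, hB, Finset.mul_sum]
      exact Finset.sum_congr rfl fun i _ => Finset.sum_congr rfl fun j _ => by
        rw [real_inner_comm (u i)]
        ring
    rwa [hBz, dotProduct_zero, inner_self_eq_zero] at h1
  have hza : z ⬝ᵥ a = 0 := by
    have h1 : z ⬝ᵥ a = inner ℝ (∑ l, z l • u l) γ := by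
      simp only [sum_inner, real_inner_smul_left, dotProduct, ha]
    rw [h1, hsum, inner_zero_left]
  have hzz : z ⬝ᵥ z = 0 := by
    conv_lhs => rw [hz, dotProduct_sub]
    rw [hza, Matrix.dotProduct_mulVec, ← Matrix.mulVec_transpose, hBt, hBz, zero_dotProduct,
      sub_zero]
  have := dotProduct_self_eq_zero.1 hzz
  exact (sub_eq_zero.1 this).symm

/-- The `u l` may be linearly dependent. The coefficients `c = B†a` still solve the normal equations
`B c = a`, so the projection is `⟪u₀, γ⟫ u₀ + ∑ c_l u_l`, an orthogonal sum. -/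
theorem norm_starProjection_spanWith_sq {H : Type*} [NormedAddCommGroup H]
    [InnerProductSpace ℝ H] {L : ℕ} (u₀ γ : H) (u : Fin L → H)
    (h₀ : inner ℝ u₀ u₀ = 1) (hu : ∀ l, inner ℝ u₀ (u l) = 0)
    (B : Matrix (Fin L) (Fin L) ℝ) (hB : ∀ l l', B l l' = inner ℝ (u l) (u l'))
    (a : Fin L → ℝ) (ha : ∀ l, a l = inner ℝ (u l) γ) :
    ‖(spanWith u₀ u).starProjection γ‖ ^ 2 = inner ℝ u₀ γ ^ 2 + a ⬝ᵥ (pinv B *ᵥ a) := by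
  set c := pinv B *ᵥ a with hc
  have hBc : B *ᵥ c = a := gram_mulVec_pinv_mulVec u γ B hB a ha
  set s := ∑ l, c l • u l with hs
  set w := inner ℝ u₀ γ • u₀ + s with hw
  have hs₀ : inner ℝ u₀ s = 0 := by
    simp [hs, inner_sum, real_inner_smul_right, hu]
  have hsl : ∀ l, inner ℝ (u l) s = a l := by
    intro l
    rw [← hBc]
    simp only [hs, inner_sum, real_inner_smul_right, Matrix.mulVec, dotProduct, hB]
    exact Finset.sum_congr rfl fun _ _ => by ring
  have hproj : (spanWith u₀ u).starProjection γ = w := by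
    refine Submodule.eq_starProjection_of_mem_orthogonal' (z := γ - w) ?_ ?_ (by simp)
    · refine Submodule.add_mem _ (Submodule.smul_mem _ _ ?_)
        (Submodule.sum_mem _ fun l _ => Submodule.smul_mem _ _ ?_)
      · exact Submodule.subset_span (Or.inl rfl)
      · exact Submodule.subset_span (Or.inr ⟨l, rfl⟩)
    · rw [spanWith, Submodule.mem_orthogonal]
      intro v hv
      induction hv using Submodule.span_induction with
      | mem v hv =>
        rcases hv with hv | ⟨l, rfl⟩
        · rw [Set.mem_singleton_iff.1 hv, inner_sub_right, hw, inner_add_right,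
            real_inner_smul_right, h₀, hs₀]
          ring
        · rw [inner_sub_right, hw, inner_add_right, real_inner_smul_right, real_inner_comm u₀, hu,
            hsl, ha]
          ring
      | zero => exact inner_zero_left _
      | add v v' _ _ h h' => rw [inner_add_left, h, h', add_zero]
      | smul r v _ h => rw [real_inner_smul_left, h, mul_zero]
  have hss : inner ℝ s s = a ⬝ᵥ c := by
    have h : ∀ t, inner ℝ s t = ∑ l, c l * inner ℝ (u l) t := fun t => by
      simp only [hs, sum_inner, real_inner_smul_left]
    rw [h]
    simp only [hsl, dotProduct]
    exact Finset.sum_congr rfl fun _ _ => mul_comm _ _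
  rw [hproj, ← real_inner_self_eq_norm_sq, hw]
  simp only [inner_add_left, inner_add_right, real_inner_smul_left, real_inner_smul_right, h₀,
    hs₀, hss, real_inner_comm u₀ s]
  ring

/-! ### Feature maps of a reproducing kernel Hilbert space -/

/-- If `φ` is a feature map of the kernel of `H`, then every function `x ↦ ⟪v, φ x⟫` belongs to
`H`, the map from `v` to this function does not increase norms, and it preserves inner products
with vectors in the closed span of the features. -/
theorem RKHS.exists_featureOperator {X H V : Type*} [NormedAddCommGroup H] [InnerProductSpace ℝ H]
    [CompleteSpace H] [RKHS ℝ H X ℝ] [NormedAddCommGroup V] [InnerProductSpace ℝ V]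
    [CompleteSpace V] (φ : X → V) (hφ : ∀ x y, inner ℝ (φ x) (φ y) = RKHS.kernel H x y 1) :
    ∃ T : V →L[ℝ] H, (∀ v x, T v x = inner ℝ v (φ x)) ∧ (∀ v, ‖T v‖ ≤ ‖v‖) ∧
      ∀ v ∈ (Submodule.span ℝ (Set.range φ)).topologicalClosure, ∀ w,
        inner ℝ (T v) (T w) = inner ℝ v w := by
  let k : X → H := fun x => RKHS.kerFun H x 1
  let e : (X →₀ ℝ) →ₗ[ℝ] H := Finsupp.linearCombination ℝ k
  let f : (X →₀ ℝ) →ₗ[ℝ] V := Finsupp.linearCombination ℝ φ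
  have hk : ∀ x y, inner ℝ (k x) (k y) = inner ℝ (φ x) (φ y) := by
    intro x y
    rw [RKHS.kerFun_inner, RKHS.kerFun_apply, hφ]
    simp
  -- Equal Gram matrices make `e c ↦ f c` well defined and isometric. It extends from the dense span
  -- of the kernel functions to an isometry `J`, whose adjoint is the required `T`.
  have hfe : ∀ c, ‖f c‖ = ‖e c‖ := by
    intro c
    have : inner ℝ (f c) (f c) = inner ℝ (e c) (e c) := by
      simp only [f, e, Finsupp.linearCombination_apply, Finsupp.sum_inner, Finsupp.inner_sum,
        inner_smul_left, inner_smul_right, hk]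
    rw [real_inner_self_eq_norm_sq, real_inner_self_eq_norm_sq] at this
    exact (sq_eq_sq₀ (norm_nonneg _) (norm_nonneg _)).1 this
  have hdense : DenseRange e := by
    have h1 := RKHS.kerFun_dense H
    have h2 : (LinearMap.range e).topologicalClosure = ⊤ := by
      rw [eq_top_iff, ← h1]
      refine Submodule.topologicalClosure_mono (Submodule.span_le.2 ?_)
      rintro _ ⟨x, v, rfl⟩
      refine ⟨Finsupp.single x v, ?_⟩
      simp only [e, k, Finsupp.linearCombination_single, ← map_smul, smul_eq_mul, mul_one]
    have h3 := (Submodule.dense_iff_topologicalClosure_eq_top).2 h2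
    exact h3
  have hbd : ∀ c, ‖f c‖ ≤ 1 * ‖e c‖ := fun c => by rw [one_mul, hfe]
  let J : H →L[ℝ] V := f.extendOfNorm e
  have hJ : ∀ c, J (e c) = f c := f.extendOfNorm_eq hdense ⟨1, hbd⟩
  have hJnorm : ∀ h, ‖J h‖ = ‖h‖ := by
    refine hdense.induction ?_ (isClosed_eq (by fun_prop) (by fun_prop))
    rintro _ ⟨c, rfl⟩
    rw [hJ, hfe]
  have hJi : ∀ h h', inner ℝ (J h) (J h') = inner ℝ h h' :=
    (LinearIsometry.mk J.toLinearMap hJnorm).inner_map_map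
  have hJk : ∀ x, J (k x) = φ x := by
    intro x
    simpa [e, f] using hJ (Finsupp.single x 1)
  refine ⟨J.adjoint, ?_, ?_, ?_⟩
  · intro v x
    have h1 : inner ℝ (J.adjoint v) (k x) = J.adjoint v x := by
      simp [k, RKHS.inner_kerFun]
    rw [← h1, ContinuousLinearMap.adjoint_inner_left, hJk]
  · intro v
    refine (J.adjoint.le_opNorm v).trans ?_
    rw [LinearIsometryEquiv.norm_map]
    refine mul_le_of_le_one_left (norm_nonneg _) ?_
    exact J.opNorm_le_bound zero_le_one fun h => by rw [hJnorm, one_mul]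
  · intro v hv w
    -- `J J*` fixes each feature, hence their span and, by continuity, its closure.
    have hsub : (Submodule.span ℝ (Set.range φ)) ≤
        LinearMap.eqLocus (J.toLinearMap ∘ₗ J.adjoint.toLinearMap) LinearMap.id := by
      rw [Submodule.span_le]
      rintro _ ⟨x, rfl⟩
      change J (J.adjoint (φ x)) = φ x
      have : J.adjoint (φ x) = k x := by
        refine ext_inner_right ℝ fun h => ?_
        rw [ContinuousLinearMap.adjoint_inner_left, ← hJk, hJi]
      rw [this, hJk]
    have hcl : IsClosed {v : V | J (J.adjoint v) = v} := isClosed_eq (by fun_prop) (by fun_prop)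
    have hv' : J (J.adjoint v) = v := closure_minimal (fun v hv => hsub hv) hcl hv
    rw [ContinuousLinearMap.adjoint_inner_right, hv']

/-! ### Derivatives along words -/

/-- Line derivatives are local, so on an open set agreement survives each letter. This is needed
because the mean identities are available only at parameters in `X`. -/
theorem wordDeriv_congr {N : ℕ} {φ ψ : EuclideanSpace ℝ (Fin N) → ℝ}
    {U : Set (EuclideanSpace ℝ (Fin N))} (hU : IsOpen U) (h : Set.EqOn φ ψ U) :
    ∀ w, Set.EqOn (wordDeriv w φ) (wordDeriv w ψ) U
  | [] => h
  | _ :: w => fun _ hx =>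
    ((wordDeriv_congr hU h w).eventuallyEq_of_mem (hU.mem_nhds hx)).lineDeriv_eq

theorem WordDerivExistsOn.congr {N : ℕ} {φ ψ : EuclideanSpace ℝ (Fin N) → ℝ}
    {U : Set (EuclideanSpace ℝ (Fin N))} (hU : IsOpen U) (h : Set.EqOn φ ψ U) :
    ∀ w, WordDerivExistsOn w φ U → WordDerivExistsOn w ψ U
  | [], _ => trivial
  | _ :: w, hw => ⟨hw.1.congr hU h w, fun x hx => (hw.2 x hx).congr_of_eventuallyEq
      ((wordDeriv_congr hU h w).symm.eventuallyEq_of_mem (hU.mem_nhds hx))⟩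

/-- The empty word returns the constant itself; this is where nonzero multi-indices enter. -/
theorem wordDeriv_const {N : ℕ} (c : ℝ) :
    ∀ w : List (Fin N), w ≠ [] → wordDeriv w (fun _ => c) = fun _ => 0
  | [], h => absurd rfl h
  | [_], _ => by
    funext x
    simp [wordDeriv, lineDeriv]
  | _ :: k :: w, _ => by
    funext x
    rw [wordDeriv, wordDeriv_const c (k :: w) (by simp)]
    simp [lineDeriv]

theorem multiWord_ne_nil {N : ℕ} {p : Fin N → ℕ} (hp : p ≠ 0) : multiWord p ≠ [] := by
  obtain ⟨k, hk⟩ := Function.ne_iff.1 hp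
  intro h
  have := List.flatMap_eq_nil_iff.1 h k (List.mem_finRange k)
  exact hk (by simpa using this)

theorem partialDeriv_zero_fun {N : ℕ} (p : Fin N → ℕ) (x : EuclideanSpace ℝ (Fin N)) :
    partialDeriv p (fun _ => 0) x = 0 := by
  by_cases h : multiWord p = []
  · simp [partialDeriv, h, wordDeriv]
  · rw [partialDeriv, wordDeriv_const 0 _ h]

namespace EstimationProblem

variable {N M : ℕ}

/-! ### Expectations under a change of the reference measure -/

theorem integrable_prob_iff (E : EstimationProblem N M) {x : EuclideanSpace ℝ (Fin N)}
    (hx : x ∈ E.X) {h : EuclideanSpace ℝ (Fin M) → ℝ} :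
    Integrable h (E.prob x) ↔ Integrable (fun y => E.f x y * h y) E.μ := by
  rw [prob, integrable_withDensity_iff_integrable_smul' (E.measurable_f x hx).ennreal_ofReal
    (Filter.Eventually.of_forall fun _ => ENNReal.ofReal_lt_top)]
  simp only [ENNReal.toReal_ofReal (E.nonneg_f x hx _), smul_eq_mul]

theorem integral_prob (E : EstimationProblem N M) {x : EuclideanSpace ℝ (Fin N)}
    (hx : x ∈ E.X) (h : EuclideanSpace ℝ (Fin M) → ℝ) :
    ∫ y, h y ∂E.prob x = ∫ y, E.f x y * h y ∂E.μ := by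
  rw [prob, integral_withDensity_eq_integral_toReal_smul (E.measurable_f x hx).ennreal_ofReal
    (Filter.Eventually.of_forall fun _ => ENNReal.ofReal_lt_top)]
  simp only [ENNReal.toReal_ofReal (E.nonneg_f x hx _), smul_eq_mul]

theorem isProbabilityMeasure_prob (E : EstimationProblem N M) {x : EuclideanSpace ℝ (Fin N)}
    (hx : x ∈ E.X) : IsProbabilityMeasure (E.prob x) :=
  ⟨by rw [prob, withDensity_apply _ MeasurableSet.univ, Measure.restrict_univ, E.lintegral_f x hx]⟩

theorem ae_mul_div_eq (E : EstimationProblem N M) (x₀ : E.X) [hA : E.Admissible x₀]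
    (G : EuclideanSpace ℝ (Fin M) → ℝ) :
    (fun y => E.f x₀ y * (1 / E.f x₀ y * G y)) =ᵐ[E.μ] G := by
  filter_upwards [hA.ne_zero] with y hy
  field_simp

/-- Integrals for the dominating measure as expectations at the reference parameter. -/
theorem integrable_iff_prob (E : EstimationProblem N M) (x₀ : E.X) [E.Admissible x₀]
    (G : EuclideanSpace ℝ (Fin M) → ℝ) :
    Integrable G E.μ ↔ Integrable (fun y => 1 / E.f x₀ y * G y) (E.prob x₀) := by
  rw [E.integrable_prob_iff x₀.2]
  exact (integrable_congr (E.ae_mul_div_eq x₀ G)).symm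

theorem integral_eq_prob (E : EstimationProblem N M) (x₀ : E.X) [E.Admissible x₀]
    (G : EuclideanSpace ℝ (Fin M) → ℝ) :
    ∫ y, G y ∂E.μ = ∫ y, 1 / E.f x₀ y * G y ∂E.prob x₀ := by
  rw [E.integral_prob x₀.2]
  exact (integral_congr_ae (E.ae_mul_div_eq x₀ G)).symm

theorem memLp_likelihoodRatio (E : EstimationProblem N M) (x₀ : E.X) [hA : E.Admissible x₀]
    {x : EuclideanSpace ℝ (Fin N)} (hx : x ∈ E.X) :
    MemLp (E.likelihoodRatio x₀ x) 2 (E.prob x₀) := by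
  have hm : Measurable (E.likelihoodRatio x₀ x) :=
    (E.measurable_f x hx).div (E.measurable_f x₀ x₀.2)
  rw [memLp_two_iff_integrable_sq hm.aestronglyMeasurable]
  simpa only [sq] using hA.integrable x hx x hx

theorem likelihoodRatio_self_ae (E : EstimationProblem N M) (x₀ : E.X) [hA : E.Admissible x₀] :
    E.likelihoodRatio x₀ x₀ =ᵐ[E.prob x₀] fun _ => 1 := by
  have : ∀ᵐ y ∂E.prob x₀, E.f x₀ y ≠ 0 :=
    (withDensity_absolutelyContinuous _ _).ae_le hA.ne_zero
  filter_upwards [this] with y hy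
  exact div_self hy

/-- A function that is square integrable at the reference parameter is integrable at every
parameter. -/
theorem integrable_of_memLp (E : EstimationProblem N M) (x₀ : E.X) [E.Admissible x₀]
    {h : EuclideanSpace ℝ (Fin M) → ℝ} (hh : MemLp h 2 (E.prob x₀))
    {x : EuclideanSpace ℝ (Fin N)} (hx : x ∈ E.X) : Integrable h (E.prob x) := by
  rw [E.integrable_prob_iff hx, E.integrable_iff_prob x₀]
  refine (hh.integrable_mul (E.memLp_likelihoodRatio x₀ hx)).congr
    (Filter.Eventually.of_forall fun y => ?_)
  simp only [Pi.mul_apply, likelihoodRatio]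
  ring

/-- No integrability of `h` is needed: both changes of density also respect the default value `0` of
the integral. -/
theorem mean_eq_integral_likelihoodRatio (E : EstimationProblem N M) (x₀ : E.X) [E.Admissible x₀]
    (h : EuclideanSpace ℝ (Fin M) → ℝ) {x : EuclideanSpace ℝ (Fin N)} (hx : x ∈ E.X) :
    E.mean h x = ∫ y, h y * E.likelihoodRatio x₀ x y ∂E.prob x₀ := by
  rw [mean, E.integral_prob hx, E.integral_eq_prob x₀]
  refine integral_congr_ae (Filter.Eventually.of_forall fun y => ?_)
  simp only [likelihoodRatio]
  ring

/-- Treating a likelihood ratio as an estimator lets regularity, which speaks of mean functions,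
differentiate the kernel. -/
theorem kernel_eq_mean (E : EstimationProblem N M) (x₀ : E.X) [E.Admissible x₀]
    (x : EuclideanSpace ℝ (Fin N)) {x' : EuclideanSpace ℝ (Fin N)} (hx' : x' ∈ E.X) :
    E.kernel x₀ x x' = E.mean (E.likelihoodRatio x₀ x) x' := by
  rw [E.mean_eq_integral_likelihoodRatio x₀ _ hx', kernel]

/-- The normalized partial derivative of order `p` of the density. -/
noncomputable def score (E : EstimationProblem N M) (x₀ : EuclideanSpace ℝ (Fin N))
    (p : Fin N → ℕ) (x : EuclideanSpace ℝ (Fin N)) (y : EuclideanSpace ℝ (Fin M)) : ℝ :=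
  1 / E.f x₀ y * partialDeriv p (fun x => E.f x y) x

/-- The part of regularity used for the projection bound: scores are square integrable, and
expectations of square integrable functions may be differentiated under the integral sign. -/
theorem Regular.exists_ball {E : EstimationProblem N M} {x₀ : E.X} [E.Admissible x₀] {m : ℕ}
    (hreg : E.Regular x₀ m) : ∃ r > 0, Metric.ball (x₀ : EuclideanSpace ℝ (Fin N)) r ⊆ E.X ∧
      ∀ p : Fin N → ℕ, (∀ k, p k ≤ m) → MemLp (E.score x₀ p x₀) 2 (E.prob x₀) ∧
        ∀ h : EuclideanSpace ℝ (Fin M) → ℝ, Measurable h → MemLp h 2 (E.prob x₀) →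
          PartialDerivExistsOn p (E.mean h) (Metric.ball x₀ r) ∧
          partialDeriv p (E.mean h) x₀ = ∫ y, h y * E.score x₀ p x₀ y ∂E.prob x₀ := by
  obtain ⟨r, hr, hball, h1, h2, -⟩ := hreg
  refine ⟨r, hr, hball, fun p hp => ⟨(h1 p hp).2 x₀ (Metric.mem_ball_self hr), ?_⟩⟩
  intro h hm hh
  have hcomm : ∀ x, (fun y => 1 / E.f x₀ y * (h y * partialDeriv p (fun x => E.f x y) x))
      = fun y => h y * E.score x₀ p x y := fun x => by
    funext y
    simp only [score]
    ring
  obtain ⟨hex, heq⟩ := h2 h hm (fun x hx => E.integrable_of_memLp x₀ hh hx) p hp fun x hx => by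
    rw [E.integrable_iff_prob x₀, hcomm]
    exact hh.integrable_mul ((h1 p hp).2 x hx)
  refine ⟨hex, ?_⟩
  rw [heq x₀ (Metric.mem_ball_self hr), E.integral_eq_prob x₀, hcomm]

end EstimationProblem

theorem MeasureTheory.MemLp.inner_toLp_toLp {α : Type*} [MeasurableSpace α] {ν : Measure α}
    {g h : α → ℝ} (hg : MemLp g 2 ν) (hh : MemLp h 2 ν) :
    inner ℝ (hg.toLp g) (hh.toLp h) = ∫ y, g y * h y ∂ν := by
  rw [L2.inner_def]
  refine integral_congr_ae ?_
  filter_upwards [hg.coeFn_toLp, hh.coeFn_toLp] with y h1 h2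
  simp only [h1, h2, RCLike.inner_apply, conj_trivial]
  ring

namespace EstimationProblem

variable {N M : ℕ}

/-- Scores are limits of linear combinations of likelihood ratios. -/
theorem toLp_score_mem_closure_span (E : EstimationProblem N M) (x₀ : E.X) [E.Admissible x₀]
    {p : Fin N → ℕ} {r : ℝ} (hr : 0 < r)
    (hball : Metric.ball (x₀ : EuclideanSpace ℝ (Fin N)) r ⊆ E.X)
    (hs : MemLp (E.score x₀ p x₀) 2 (E.prob x₀))
    (hd : ∀ h : EuclideanSpace ℝ (Fin M) → ℝ, Measurable h → MemLp h 2 (E.prob x₀) →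
      partialDeriv p (E.mean h) x₀ = ∫ y, h y * E.score x₀ p x₀ y ∂E.prob x₀) :
    hs.toLp ∈ (Submodule.span ℝ (Set.range fun x : E.X =>
      (E.memLp_likelihoodRatio x₀ x.2).toLp)).topologicalClosure := by
  -- By duality, it suffices that each `v` orthogonal to all likelihood ratios is orthogonal to the
  -- score. Such a `v` has zero mean on the ball, so the derivative of its mean vanishes.
  rw [← Submodule.orthogonal_orthogonal_eq_closure, Submodule.mem_orthogonal]
  intro v hv
  -- Regularity applies to measurable functions, so a measurable representative is chosen.
  obtain ⟨h, hm, hvh⟩ := (Lp.aestronglyMeasurable v).aemeasurable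
  have hh : MemLp h 2 (E.prob x₀) := (memLp_congr_ae hvh).1 (Lp.memLp v)
  have hv' : v = hh.toLp := by
    rw [← Lp.toLp_coeFn v (Lp.memLp v)]
    exact MemLp.toLp_congr _ _ hvh
  have hmean : Set.EqOn (E.mean h) (fun _ => 0) (Metric.ball x₀ r) := by
    intro x hx
    have h1 := (Submodule.mem_orthogonal _ _).1 hv _ (Submodule.subset_span ⟨⟨x, hball hx⟩, rfl⟩)
    rw [real_inner_comm, hv', MemLp.inner_toLp_toLp] at h1
    rw [E.mean_eq_integral_likelihoodRatio x₀ _ (hball hx), h1]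
  rw [hv', MemLp.inner_toLp_toLp, ← hd h hm hh, partialDeriv,
    wordDeriv_congr Metric.isOpen_ball hmean _ (Metric.mem_ball_self hr)]
  exact partialDeriv_zero_fun p _

end EstimationProblem

theorem theorem3 {N M : ℕ} (E : EstimationProblem N M) (x₀ : E.X) [E.Admissible x₀]
    (hx₀ : (x₀ : EuclideanSpace ℝ (Fin N)) ∈ interior E.X)
    (m : ℕ) (hm : 1 ≤ m) (hreg : E.Regular x₀ m)
    {L : ℕ} (p : Fin L → Fin N → ℕ) (hp_inj : Function.Injective p)
    (hp_ne : ∀ l, p l ≠ 0) (hp_le : ∀ l k, p l k ≤ m)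
    (ghat : EuclideanSpace ℝ (Fin M) → ℝ) (hghat : Measurable ghat)
    (hvar : MemLp ghat 2 (E.prob x₀)) :
    (∀ x ∈ E.X, Integrable ghat (E.prob x)) ∧
    (∀ l, PartialDerivExistsNear (p l) (E.mean ghat) x₀) ∧
    (∀ l, ∀ x : E.X, PartialDerivExistsNear (p l) (fun x₂ => E.kernel x₀ x x₂) x₀) ∧
    ∃ (γ u₀ : E.rkhs x₀) (u : Fin L → E.rkhs x₀),
      (∀ x : E.X, γ x = E.mean ghat x) ∧
      (∀ x : E.X, u₀ x = E.kernel x₀ x x₀) ∧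
      (∀ l, ∀ x : E.X, u l x = partialDeriv (p l) (fun x₂ => E.kernel x₀ x x₂) x₀) ∧
      ‖(spanWith u₀ u).starProjection γ‖ ^ 2 - E.mean ghat x₀ ^ 2
        ≤ variance ghat (E.prob x₀) ∧
      ‖(spanWith u₀ u).starProjection γ‖ ^ 2 - E.mean ghat x₀ ^ 2
        = E.bhattVector x₀ p ghat ⬝ᵥ (pinv (E.bhattMatrix x₀ p) *ᵥ E.bhattVector x₀ p ghat) := by
  have hprob := E.isProbabilityMeasure_prob x₀.2
  obtain ⟨r, hr, hball, hR⟩ := hreg.exists_ball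
  have hs := fun l => (hR (p l) (hp_le l)).1
  have hd := fun l => (hR (p l) (hp_le l)).2
  have hρ := fun x : E.X => E.memLp_likelihoodRatio x₀ x.2
  have hρm : ∀ x : E.X, Measurable (E.likelihoodRatio x₀ x) := fun x =>
    (E.measurable_f x x.2).div (E.measurable_f x₀ x₀.2)
  have hk : ∀ x : E.X, Set.EqOn (E.mean (E.likelihoodRatio x₀ x)) (fun x₂ => E.kernel x₀ x x₂)
      (Metric.ball x₀ r) := fun x x₂ hx₂ => (E.kernel_eq_mean x₀ x (hball hx₂)).symm
  refine ⟨fun x hx => E.integrable_of_memLp x₀ hvar hx,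
    fun l => ⟨r, hr, (hd l ghat hghat hvar).1⟩,
    fun l x => ⟨r, hr, (hd l _ (hρm x) (hρ x)).1.congr Metric.isOpen_ball (hk x)⟩, ?_⟩
  let φ : E.X → Lp ℝ 2 (E.prob x₀) := fun x => (hρ x).toLp
  have hφ : ∀ x y : E.X, inner ℝ (φ x) (φ y) = RKHS.kernel (E.rkhs x₀) x y 1 := by
    intro x y
    rw [MemLp.inner_toLp_toLp, RKHS.OfKernel.kernel_ofKernel]
    simp [EstimationProblem.kernelMatrix, EstimationProblem.kernel]
  obtain ⟨T, hT, hTle, hTi⟩ := RKHS.exists_featureOperator (H := E.rkhs x₀) φ hφ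
  have hφmem : ∀ x, φ x ∈ (Submodule.span ℝ (Set.range φ)).topologicalClosure := fun x =>
    Submodule.le_topologicalClosure _ (Submodule.subset_span ⟨x, rfl⟩)
  have hsmem : ∀ l, (hs l).toLp ∈ (Submodule.span ℝ (Set.range φ)).topologicalClosure := fun l =>
    E.toLp_score_mem_closure_span x₀ hr hball (hs l) fun h hm hh => (hd l h hm hh).2
  have hmean : inner ℝ (T (φ x₀)) (T hvar.toLp) = E.mean ghat x₀ := by
    rw [hTi _ (hφmem x₀), real_inner_comm, MemLp.inner_toLp_toLp,
      E.mean_eq_integral_likelihoodRatio x₀ _ x₀.2]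
  have hφ₀ : inner ℝ (T (φ x₀)) (T (φ x₀)) = 1 := by
    rw [hTi _ (hφmem x₀), MemLp.inner_toLp_toLp,
      integral_congr_ae (g := fun _ => (1 : ℝ))
        (by filter_upwards [E.likelihoodRatio_self_ae x₀] with y hy; rw [hy, one_mul])]
    simp
  have hortho : ∀ l, inner ℝ (T (φ x₀)) (T (hs l).toLp) = 0 := by
    intro l
    -- Total mass is `1` throughout the ball, so its derivative of nonzero order, which is the mean
    -- of the score, vanishes.
    have h1 : Set.EqOn (E.mean fun _ => 1) (fun _ => 1) (Metric.ball x₀ r) := by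
      intro x hx
      have := E.isProbabilityMeasure_prob (hball hx)
      simp [EstimationProblem.mean]
    rw [hTi _ (hφmem x₀), MemLp.inner_toLp_toLp,
      integral_congr_ae (g := fun y => 1 * E.score x₀ (p l) x₀ y)
        (by filter_upwards [E.likelihoodRatio_self_ae x₀] with y hy; rw [hy]),
      ← (hd l (fun _ => 1) measurable_const (memLp_const 1)).2, partialDeriv,
      wordDeriv_congr Metric.isOpen_ball h1 _ (Metric.mem_ball_self hr),
      wordDeriv_const 1 _ (multiWord_ne_nil (hp_ne l))]
  have hnorm := norm_starProjection_spanWith_sq (T (φ x₀)) (T hvar.toLp)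
    (fun l => T (hs l).toLp) hφ₀ hortho (E.bhattMatrix x₀ p)
    (fun l l' => by
      rw [hTi _ (hsmem l), MemLp.inner_toLp_toLp, EstimationProblem.bhattMatrix, Matrix.of_apply]
      refine integral_congr_ae (Filter.Eventually.of_forall fun y => ?_)
      simp only [EstimationProblem.score]
      ring)
    (E.bhattVector x₀ p ghat)
    (fun l => by
      rw [hTi _ (hsmem l), real_inner_comm, MemLp.inner_toLp_toLp, EstimationProblem.bhattVector,
        (hd l ghat hghat hvar).2])
  rw [hmean] at hnorm
  refine ⟨T hvar.toLp, T (φ x₀), fun l => T (hs l).toLp, ?_, ?_, ?_, ?_, ?_⟩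
  · intro x
    rw [hT, MemLp.inner_toLp_toLp, E.mean_eq_integral_likelihoodRatio x₀ _ x.2]
  · intro x
    rw [hT, MemLp.inner_toLp_toLp, E.kernel_comm, EstimationProblem.kernel]
  · intro l x
    rw [hT, real_inner_comm, MemLp.inner_toLp_toLp, ← (hd l _ (hρm x) (hρ x)).2, partialDeriv,
      partialDeriv, wordDeriv_congr Metric.isOpen_ball (hk x) _ (Metric.mem_ball_self hr)]
  -- The estimator need not lie in the closed span of the likelihood ratios, so only the contraction
  -- property of `T` is available here.
  · have h1 : ‖(spanWith (T (φ x₀)) fun l => T (hs l).toLp).starProjection (T hvar.toLp)‖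
        ≤ ‖hvar.toLp‖ := (Submodule.norm_starProjection_apply_le _ _).trans (hTle _)
    have h2 : ‖hvar.toLp‖ ^ 2 = ∫ y, (ghat ^ 2) y ∂E.prob x₀ := by
      rw [← real_inner_self_eq_norm_sq, MemLp.inner_toLp_toLp]
      simp only [Pi.pow_apply, sq]
    rw [variance_eq_sub hvar, ← h2]
    exact sub_le_sub_right (pow_le_pow_left₀ (norm_nonneg _) h1 2) _
  · rw [hnorm, add_sub_cancel_left]
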